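/- Let $0<\alpha<\pi/2$ and let $P$ be a finite set of points (terminals) in the Euclidean plane; the root $r$ is the origin. A *flux tree* for $P$ is a finite tree rooted at $r$, drawn in the plane, whose nodes include all terminals (further Steiner nodes are allowed) and whose arcs, directed towards the root, are continuous, piecewise differentiable curves such that, at every point $p$ of an arc outside finitely many exceptional points, the arc has a tangent vector and the angle between it and the vector from $p$ to $r$ is at most $\alpha$. A *spiral tree* is a flux tree each of whose arcs consists of finitely many segments of logarithmic spirals $R(t)=Re^{-t}$, $\phi(t)=\phi\pm t\tan\alpha$. The length of a tree is the sum of the lengths of its arcs, and a flux tree (spiral tree) is optimal if it has minimum length among all flux trees (spiral trees) for $P$. Let $n=|P|$, and let $\mathrm{MST}$ be the length of a Euclidean minimum spanning tree of $P\cup\{r\}$. **Theorem.** 1. If $n\ge 2$, then there is a spiral tree for $P$ of length at most $$3\,\lceil\log_2 n\rceil\,\max(\sec\alpha,\csc\alpha)\cdot \mathrm{MST};$$ in particular every optimal spiral tree satisfies this bound. 2. There is an absolute constant $C>0$ such that for all $\alpha\in(0,\pi/2)$ and all $P$ with $n\ge2$ there is a flux tree for $P$ of length at most $C(\sec\alpha+\csc\alpha)\log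 n\cdot\mathrm{MST}$; in particular every optimal flux tree satisfies this bound. 3. For every $\alpha\in(0,\pi/2)$, every finite $P$ and every flux tree $T$ for $P$ (in particular every optimal flux tree and every spiral tree), and for every point $p$ on $T$, the length $d^T(p)$ of the path in $T$ from $p$ to the root is at most $\sec(\alpha)$ times the Euclidean distance from $p$ to the root. -/

import Mathlib

/-!
  The plane is `ℂ` (its norm is the Euclidean norm) and the root is the origin.
-/

/-- A (piecewise smooth) arc `γ : [0,1] → ℂ` from `p` to `q`, directed towards the root `0`, that
satisfies the angle restriction `α`: except at finitely many parameters, `γ` has a tangent vector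
and the angle between it and the vector `0 - γ t` to the root is at most `α`.
(`InnerProductGeometry.angle` is `π / 2 > α` if a vector is zero, so `γ` is regular there.) -/
def IsAngleRestrictedArc (α : ℝ) (γ : ℝ → ℂ) (p q : ℂ) : Prop :=
  γ 0 = p ∧ γ 1 = q ∧ ContinuousOn γ (Set.Icc 0 1) ∧
    ∃ S : Finset ℝ, ∀ t ∈ Set.Ioo (0 : ℝ) 1, t ∉ S →
      DifferentiableAt ℝ γ t ∧ InnerProductGeometry.angle (deriv γ t) (0 - γ t) ≤ α

/-- The logarithmic spiral through `p` in polar coordinates: `R(t) = R e^{-t}`,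
`φ(t) = φ + σ tan(α) t`. It is the right spiral for `σ = 1` and the left spiral for `σ = -1`. -/
def logSpiral (α σ : ℝ) (p : ℂ) : Set ℂ :=
  {z | ∃ t : ℝ, z = p * Complex.exp (((-t : ℝ) : ℂ) + ((σ * Real.tan α * t : ℝ) : ℂ) * Complex.I)}

/-- An angle-restricted arc that consists of finitely many segments of right and left logarithmic
spirals: between any two consecutive breakpoints the arc stays on a single spiral. -/
def IsSpiralArc (α : ℝ) (γ : ℝ → ℂ) (p q : ℂ) : Prop :=
  IsAngleRestrictedArc α γ p q ∧
    ∃ S : Finset ℝ, ∀ a b : ℝ, 0 ≤ a → a < b → b ≤ 1 → (∀ s ∈ S, s ∉ Set.Ioo a b) →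
      ∃ (σ : ℝ) (c : ℂ), (σ = 1 ∨ σ = -1) ∧ ∀ t ∈ Set.Ioo a b, γ t ∈ logSpiral α σ c

/-- A flux tree (angle-restricted Steiner arborescence) for the terminal set `P`, with the root at
the origin and arcs directed towards the root. Every node `v` other than the root has one outgoing
arc, to `parent v`. Nodes that are not terminals are Steiner nodes. -/
structure FluxTree (α : ℝ) (P : Finset ℂ) where
  Node : Type
  fintypeNode : Fintype Node
  root : Node
  parent : Node → Node
  pos : Node → ℂ
  arc : Node → ℝ → ℂ
  pos_root : pos root = 0
  parent_root : parent root = root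
  reaches_root : ∀ v, ∃ k : ℕ, parent^[k] v = root
  terminal_mem : ∀ p ∈ P, ∃ v, pos v = p
  arc_restricted : ∀ v, v ≠ root → IsAngleRestrictedArc α (arc v) (pos v) (pos (parent v))

namespace FluxTree

variable {α : ℝ} {P : Finset ℂ}

/-- The length of the arc that leaves `v`. -/
noncomputable def arcLength (T : FluxTree α P) (v : T.Node) : ENNReal :=
  eVariationOn (T.arc v) (Set.Icc 0 1)

open Classical in
/-- The length of a flux tree: the sum of the lengths of its arcs. -/
noncomputable def length (T : FluxTree α P) : ENNReal :=
  letI := T.fintypeNode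
  ∑ v ∈ Finset.univ.filter (fun v => v ≠ T.root), T.arcLength v

open Classical in
/-- The length of the path in the tree from the node `v` to the root: the sum of the lengths of the
arcs that leave `v` and its ancestors. -/
noncomputable def nodeDist (T : FluxTree α P) (v : T.Node) : ENNReal :=
  letI := T.fintypeNode
  ∑ u ∈ Finset.univ.filter (fun u => u ≠ T.root ∧ ∃ k : ℕ, T.parent^[k] v = u), T.arcLength u

/-- The length of the path in the tree to the root from the point with parameter `t` on the arc that
leaves `v`. -/
noncomputable def pointDist (T : FluxTree α P) (v : T.Node) (t : ℝ) : ENNReal :=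
  eVariationOn (T.arc v) (Set.Icc t 1) + T.nodeDist (T.parent v)

/-- A flux tree is a spiral tree if its arcs consist only of spiral segments. -/
def IsSpiralTree (T : FluxTree α P) : Prop :=
  ∀ v, v ≠ T.root → IsSpiralArc α (T.arc v) (T.pos v) (T.pos (T.parent v))

/-- An optimal (shortest) flux tree. -/
def IsOptimal (T : FluxTree α P) : Prop :=
  ∀ T' : FluxTree α P, T.length ≤ T'.length

/-- An optimal (shortest) spiral tree. -/
def IsOptimalSpiralTree (T : FluxTree α P) : Prop :=
  T.IsSpiralTree ∧ ∀ T' : FluxTree α P, T'.IsSpiralTree → T.length ≤ T'.length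

end FluxTree

open Classical in
/-- The total Euclidean length of the edges of a geometric graph. -/
noncomputable def graphLength {Q : Finset ℂ} (G : SimpleGraph Q) : ℝ :=
  ∑ e ∈ G.edgeFinset, Sym2.lift ⟨fun x y : Q => dist x y, fun x y => dist_comm x y⟩ e

/-- `G` is a Euclidean minimum spanning tree of the finite point set `Q`. -/
def IsMinSpanningTree {Q : Finset ℂ} (G : SimpleGraph Q) : Prop :=
  G.IsTree ∧ ∀ G' : SimpleGraph Q, G'.IsTree → graphLength G ≤ graphLength G'

/-- The terminals together with the root. -/
noncomputable def withRoot (P : Finset ℂ) : Finset ℂ := insert 0 P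

/-! ### Lengths of angle-restricted arcs -/

/-! The angle restriction makes the distance to the root fall at rate at least `cos α` per unit of
length. So an arc is at most `sec α` times as long as the drop in radius along it
(`IsAngleRestrictedArc.eVariationOn_le`). Telescoping this along a path to the root gives the
distance bound, and it turns every tree length into a sum of radius drops.

For the upper bound, use the coordinates `tan α * log R ± φ` on the universal cover of the punctured
plane. The two spirals through a point lower one coordinate each, and the meet `x ⊓ y` is where
spirals from `x` and `y` join. The drop in radius caused by joining, `joinCost`, is at most `3/2 *
max 1 (cot α)` times the Euclidean distance if the lifted angles differ by at most `π`
(`joinCost_le`).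

A spanning tree gives a tour from the root of length at most twice its own. Join the tour's
terminals pairwise by halving. The radius is supermodular (`spiralRadius_add_le`), so joining the
meets of two adjacent blocks costs at most the sum of the consecutive join costs inside them
(`joinCost_isGLB_le`). Hence each of the `⌈log₂ n⌉` levels costs at most that sum, and the tour's
first edge pays for the last spiral into the root. The constant is `3/2 * 2 = 3`, and `sec α * max 1
(cot α) = max (sec α) (csc α)`. Spiral trees are flux trees, so the second bound follows. -/

theorem le_of_deriv_nonneg_off_finset {f : ℝ → ℝ} (S : Finset ℝ) :
    ∀ {a b : ℝ}, a ≤ b → ContinuousOn f (Set.Icc a b) →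
      (∀ t ∈ Set.Ioo a b, t ∉ S → DifferentiableAt ℝ f t ∧ 0 ≤ deriv f t) → f a ≤ f b := by
  induction S using Finset.induction_on with
  | empty =>
    intro a b hab hc hd
    refine monotoneOn_of_deriv_nonneg (convex_Icc a b) hc ?_ ?_
      (Set.left_mem_Icc.2 hab) (Set.right_mem_Icc.2 hab) hab
    · rw [interior_Icc]
      exact fun t ht => (hd t ht (by simp)).1.differentiableWithinAt
    · rw [interior_Icc]
      exact fun t ht => (hd t ht (by simp)).2
  | insert s S _ ih =>
    intro a b hab hc hd
    by_cases hs : s ∈ Set.Ioo a b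
    · refine (ih hs.1.le (hc.mono (Set.Icc_subset_Icc_right hs.2.le)) fun t ht htS => ?_).trans
        (ih hs.2.le (hc.mono (Set.Icc_subset_Icc_left hs.1.le)) fun t ht htS => ?_)
      · exact hd t ⟨ht.1, ht.2.trans hs.2⟩ (by simp [htS, ht.2.ne])
      · exact hd t ⟨hs.1.trans ht.1, ht.2⟩ (by simp [htS, ht.1.ne'])
    · refine ih hab hc fun t ht htS => hd t ht ?_
      have : t ≠ s := fun h => hs (h ▸ ht)
      simp [this, htS]

/-- Comparing with the fixed chord direction `u` replaces integrating the speed, so no integrability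
of `deriv γ` is needed. -/
theorem IsAngleRestrictedArc.cos_mul_norm_sub_le {α : ℝ} (h0 : 0 < α) (h1 : α < Real.pi / 2)
    {γ : ℝ → ℂ} {p q : ℂ} (h : IsAngleRestrictedArc α γ p q) {a b : ℝ} (ha : 0 ≤ a)
    (hab : a ≤ b) (hb : b ≤ 1) :
    Real.cos α * ‖γ b - γ a‖ ≤ ‖γ a‖ - ‖γ b‖ := by
  obtain ⟨-, -, hc, S, hS⟩ := h
  rcases eq_or_ne (γ b) (γ a) with heq | hne
  · simp [heq]
  have hcos : 0 < Real.cos α := Real.cos_pos_of_mem_Ioo ⟨by linarith, h1⟩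
  have hn : 0 < ‖γ b - γ a‖ := norm_pos_iff.2 (sub_ne_zero.2 hne)
  set u : ℂ := γ b - γ a with hu
  have hc' := hc.mono (Set.Icc_subset_Icc ha hb)
  -- The derivative is at least `‖u‖ * cos α * ‖γ'‖ - cos α * ⟪u, γ'⟫`, which is nonnegative by
  -- Cauchy–Schwarz.
  have key : (fun t => -(‖u‖ * ‖γ t‖) - Real.cos α * inner ℝ u (γ t)) a ≤
      (fun t => -(‖u‖ * ‖γ t‖) - Real.cos α * inner ℝ u (γ t)) b := by
    refine le_of_deriv_nonneg_off_finset
      (f := fun t => -(‖u‖ * ‖γ t‖) - Real.cos α * inner ℝ u (γ t)) S hab ?_ ?_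
    · exact ((continuousOn_const.mul hc'.norm).neg).sub
        (continuousOn_const.mul (continuousOn_const.inner hc'))
    · intro t ht htS
      obtain ⟨hd, hang⟩ := hS t ⟨ha.trans_lt ht.1, ht.2.trans_le hb⟩ htS
      have hne0 : γ t ≠ 0 := by
        intro h
        rw [h, sub_zero, InnerProductGeometry.angle_zero_right] at hang
        linarith
      have hnorm : HasDerivAt (fun s => ‖γ s‖) (inner ℝ (γ t) (deriv γ t) / ‖γ t‖) t := by
        have h2 := (hd.hasDerivAt.norm_sq).sqrt (by positivity)
        simp only [Real.sqrt_sq (norm_nonneg _)] at h2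
        convert h2 using 1
        have : ‖γ t‖ ≠ 0 := norm_ne_zero_iff.2 hne0
        field_simp
      have hinner : HasDerivAt (fun s => inner ℝ u (γ s)) (inner ℝ u (deriv γ t)) t := by
        simpa using (hasDerivAt_const t u).inner ℝ hd.hasDerivAt
      have hD : HasDerivAt (fun t => -(‖u‖ * ‖γ t‖) - Real.cos α * inner ℝ u (γ t)) _ t :=
        ((hnorm.const_mul ‖u‖).neg).sub (hinner.const_mul (Real.cos α))
      refine ⟨hD.differentiableAt, ?_⟩
      rw [HasDerivAt.deriv hD]
      have hpos : 0 < ‖γ t‖ := norm_pos_iff.2 hne0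
      have hcosle : Real.cos α ≤ Real.cos (InnerProductGeometry.angle (deriv γ t) (0 - γ t)) :=
        Real.cos_le_cos_of_nonneg_of_le_pi (InnerProductGeometry.angle_nonneg _ _)
          (by linarith [Real.pi_pos]) hang
      have hmul := InnerProductGeometry.cos_angle_mul_norm_mul_norm (deriv γ t) (0 - γ t)
      rw [zero_sub, norm_neg, inner_neg_right, real_inner_comm] at hmul
      rw [zero_sub] at hcosle
      have hle : Real.cos α * ‖deriv γ t‖ ≤ -(inner ℝ (γ t) (deriv γ t) / ‖γ t‖) := by
        rw [← neg_div, le_div_iff₀ hpos, ← hmul, mul_assoc]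
        gcongr
      have hcs := real_inner_le_norm u (deriv γ t)
      have h3 := mul_le_mul_of_nonneg_left hle hn.le
      have h4 := mul_le_mul_of_nonneg_left hcs hcos.le
      linarith
  have hin : inner ℝ u (γ b) - inner ℝ u (γ a) = ‖u‖ * ‖u‖ := by
    rw [← inner_sub_right, ← hu, real_inner_self_eq_norm_mul_norm]
  have h5 : Real.cos α * (‖u‖ * ‖u‖) ≤ ‖u‖ * (‖γ a‖ - ‖γ b‖) := by
    rw [← hin]
    simp only at key
    linarith
  refine le_of_mul_le_mul_left ?_ hn
  linarith

theorem IsAngleRestrictedArc.eVariationOn_le {α : ℝ} (h0 : 0 < α) (h1 : α < Real.pi / 2)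
    {γ : ℝ → ℂ} {p q : ℂ} (h : IsAngleRestrictedArc α γ p q) {a b : ℝ} (ha : 0 ≤ a)
    (hab : a ≤ b) (hb : b ≤ 1) :
    eVariationOn γ (Set.Icc a b) ≤ ENNReal.ofReal (1 / Real.cos α * (‖γ a‖ - ‖γ b‖)) := by
  have hcos : 0 < Real.cos α := Real.cos_pos_of_mem_Ioo ⟨by linarith, h1⟩
  -- Increments of `γ` are dominated by those of the monotone function `g`, whose variation is just
  -- the difference of its end values.
  set g : ℝ → ℝ := fun t => -(1 / Real.cos α * ‖γ t‖) with hg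
  have hdist : ∀ s ∈ Set.Icc a b, ∀ t ∈ Set.Icc a b, s ≤ t → ‖γ t - γ s‖ ≤ g t - g s := by
    intro s hs t ht hst
    have := h.cos_mul_norm_sub_le h0 h1 (ha.trans hs.1) hst (ht.2.trans hb)
    have h2 : ‖γ t - γ s‖ ≤ (‖γ s‖ - ‖γ t‖) / Real.cos α := by
      rw [le_div_iff₀ hcos]; linarith
    refine h2.trans (le_of_eq ?_)
    simp only [hg]; ring
  have hmono : MonotoneOn g (Set.Icc a b) := fun s hs t ht hst => by
    linarith [hdist s hs t ht hst, norm_nonneg (γ t - γ s)]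
  calc eVariationOn γ (Set.Icc a b) ≤ eVariationOn g (Set.Icc a b) := by
        refine iSup_le fun ⟨n, u, hu, hus⟩ => ?_
        refine le_trans (Finset.sum_le_sum fun i _ => ?_) (eVariationOn.sum_le (n := n) hu hus)
        have hst := hu (Nat.le_succ i)
        have h3 := hdist _ (hus i) _ (hus (i + 1)) hst
        rw [edist_dist, edist_dist, dist_eq_norm, Real.dist_eq]
        exact ENNReal.ofReal_le_ofReal (h3.trans (le_abs_self _))
    _ = eVariationOn g (Set.Icc a b ∩ Set.Icc a b) := by rw [Set.inter_self]
    _ = ENNReal.ofReal (g b - g a) :=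
        hmono.eVariationOn_eq (Set.left_mem_Icc.2 hab) (Set.right_mem_Icc.2 hab)
    _ = _ := by congr 1; simp only [hg]; ring

namespace FluxTree

variable {α : ℝ} {P : Finset ℂ}

theorem arcLength_le (h0 : 0 < α) (h1 : α < Real.pi / 2) (T : FluxTree α P) {v : T.Node}
    (hv : v ≠ T.root) :
    T.arcLength v ≤ ENNReal.ofReal (1 / Real.cos α * (‖T.pos v‖ - ‖T.pos (T.parent v)‖)) := by
  have h := T.arc_restricted v hv
  have h2 := h.eVariationOn_le h0 h1 le_rfl zero_le_one le_rfl
  rwa [h.1, h.2.1] at h2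

theorem nodeDist_root (T : FluxTree α P) : T.nodeDist T.root = 0 := by
  classical
  unfold nodeDist
  refine Finset.sum_eq_zero fun u hu => ?_
  obtain ⟨-, hu, k, hk⟩ := Finset.mem_filter.1 hu
  rw [Function.iterate_fixed T.parent_root] at hk
  exact absurd hk.symm hu

theorem nodeDist_le (T : FluxTree α P) (v : T.Node) :
    T.nodeDist v ≤ T.arcLength v + T.nodeDist (T.parent v) := by
  classical
  unfold nodeDist
  let := T.fintypeNode
  refine le_trans (Finset.sum_le_sum_of_subset (t := {v} ∪ Finset.univ.filter
    (fun u => u ≠ T.root ∧ ∃ k : ℕ, T.parent^[k] (T.parent v) = u)) fun u hu => ?_) ?_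
  · obtain ⟨-, hu, k, hk⟩ := Finset.mem_filter.1 hu
    rcases k with _ | k
    · exact Finset.mem_union_left _ (Finset.mem_singleton.2 hk.symm)
    · exact Finset.mem_union_right _ (Finset.mem_filter.2 ⟨Finset.mem_univ _, hu, k, hk⟩)
  · rw [← Finset.sum_singleton T.arcLength v]
    refine le_trans le_self_add (Finset.sum_union_inter.le.trans (le_of_eq ?_))
    congr!

/-- The radius drops of the successive arcs telescope down to the root, by induction on the number
of parent steps. -/
theorem nodeDist_le_norm (h0 : 0 < α) (h1 : α < Real.pi / 2) (T : FluxTree α P) (v : T.Node) :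
    T.nodeDist v ≤ ENNReal.ofReal (1 / Real.cos α * ‖T.pos v‖) := by
  have hcos : 0 < Real.cos α := Real.cos_pos_of_mem_Ioo ⟨by linarith, h1⟩
  obtain ⟨k, hk⟩ := T.reaches_root v
  induction k generalizing v with
  | zero =>
    rw [show v = T.root from hk, nodeDist_root]
    exact zero_le
  | succ k ih =>
    by_cases hv : v = T.root
    · rw [hv, nodeDist_root]
      exact zero_le
    have h := T.arc_restricted v hv
    have hle := h.cos_mul_norm_sub_le h0 h1 le_rfl zero_le_one le_rfl
    rw [h.1, h.2.1] at hle
    have hnn : 0 ≤ ‖T.pos v‖ - ‖T.pos (T.parent v)‖ := le_trans (by positivity) hle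
    refine (T.nodeDist_le v).trans ((add_le_add (T.arcLength_le h0 h1 hv) (ih _ hk)).trans ?_)
    rw [← ENNReal.ofReal_add (by positivity) (by positivity)]
    exact ENNReal.ofReal_le_ofReal (le_of_eq (by ring))

theorem pointDist_le (h0 : 0 < α) (h1 : α < Real.pi / 2) (T : FluxTree α P) {v : T.Node}
    (hv : v ≠ T.root) {t : ℝ} (ht : t ∈ Set.Icc (0 : ℝ) 1) :
    T.pointDist v t ≤ ENNReal.ofReal (1 / Real.cos α * ‖T.arc v t‖) := by
  have hcos : 0 < Real.cos α := Real.cos_pos_of_mem_Ioo ⟨by linarith, h1⟩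
  have h := T.arc_restricted v hv
  have hle := h.cos_mul_norm_sub_le h0 h1 ht.1 ht.2 le_rfl
  have hnn : 0 ≤ ‖T.arc v t‖ - ‖T.arc v 1‖ := le_trans (by positivity) hle
  refine (add_le_add (h.eVariationOn_le h0 h1 ht.1 ht.2 le_rfl)
    (T.nodeDist_le_norm h0 h1 _)).trans ?_
  rw [← h.2.1, ← ENNReal.ofReal_add (by positivity) (by positivity)]
  exact ENNReal.ofReal_le_ofReal (le_of_eq (by ring))

end FluxTree

/-! ### Spiral arcs -/

/-- The point of the plane with spiral coordinates `x`: in polar coordinates, its radius is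
`exp ((x.1 + x.2) / (2 tan α))` and its angle `(x.1 - x.2) / 2`. The left and right spirals towards
the root decrease one of the coordinates. -/
noncomputable def spiralPoint (α : ℝ) (x : ℝ × ℝ) : ℂ :=
  Complex.exp ((((x.1 + x.2) / (2 * Real.tan α) : ℝ) : ℂ) + (((x.1 - x.2) / 2 : ℝ) : ℂ) * Complex.I)

/-- The distance to the root in spiral coordinates. -/
noncomputable def spiralRadius (α : ℝ) (x : ℝ × ℝ) : ℝ :=
  Real.exp ((x.1 + x.2) / (2 * Real.tan α))

theorem norm_spiralPoint (α : ℝ) (x : ℝ × ℝ) : ‖spiralPoint α x‖ = spiralRadius α x := by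
  rw [spiralPoint, Complex.norm_exp, spiralRadius]
  simp only [Complex.add_re, Complex.mul_re, Complex.ofReal_re, Complex.ofReal_im, Complex.I_re,
    Complex.I_im, mul_zero, zero_mul, sub_zero, add_zero]

theorem spiralPoint_ne_zero (α : ℝ) (x : ℝ × ℝ) : spiralPoint α x ≠ 0 :=
  Complex.exp_ne_zero _

/-- Dividing by `z` reduces to the angle between `c * (-1 + σ * tan α * I)` and `-1`, which is
exactly `α`. -/
theorem angle_spiral_tangent_le {α σ c : ℝ} (h0 : 0 < α) (h1 : α < Real.pi / 2)
    (hσ : σ = 1 ∨ σ = -1) (hc : 0 < c) {z : ℂ} (hz : z ≠ 0) :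
    InnerProductGeometry.angle (z * ((-c : ℝ) + (σ * Real.tan α * c : ℝ) * Complex.I)) (0 - z)
      ≤ α := by
  have hcos : 0 < Real.cos α := Real.cos_pos_of_mem_Ioo ⟨by linarith, h1⟩
  have hw : ‖(((-c : ℝ) : ℂ) + ((σ * Real.tan α * c : ℝ) : ℂ) * Complex.I)‖ = c / Real.cos α := by
    rw [Complex.norm_add_mul_I, Real.sqrt_eq_iff_eq_sq (by positivity) (by positivity)]
    have hs : σ ^ 2 = 1 := by rcases hσ with rfl | rfl <;> norm_num
    have h2 : (Real.tan α * Real.cos α) = Real.sin α := Real.tan_mul_cos hcos.ne'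
    have h3 := Real.sin_sq_add_cos_sq α
    rw [← h2] at h3
    rw [div_pow, eq_div_iff (by positivity)]
    linear_combination (c ^ 2) * h3 + c ^ 2 * Real.tan α ^ 2 * Real.cos α ^ 2 * hs
  rw [show (0 : ℂ) - z = z * (-1) by ring, Complex.angle_mul_left hz]
  rw [InnerProductGeometry.angle, hw, Complex.inner]
  simp only [norm_neg, norm_one]
  refine le_of_eq ?_
  rw [show (_ : ℝ) / _ = Real.cos α from ?_]
  · exact Real.arccos_cos h0.le (by linarith)
  · simp
    field_simp

theorem spiral_tangent {α σ c : ℝ} (h0 : 0 < α) (h1 : α < Real.pi / 2) (hσ : σ = 1 ∨ σ = -1)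
    {γ : ℝ → ℂ} {p : ℂ} (hp : p ≠ 0) {f : ℝ → ℝ} {t : ℝ} (hf : HasDerivAt f c t) (hc : 0 < c)
    (hγ : γ =ᶠ[nhds t] fun s => p * Complex.exp (((-(f s) : ℝ) : ℂ) +
      ((σ * Real.tan α * f s : ℝ) : ℂ) * Complex.I)) :
    DifferentiableAt ℝ γ t ∧ InnerProductGeometry.angle (deriv γ t) (0 - γ t) ≤ α := by
  have hd : HasDerivAt γ (γ t * ((-c : ℝ) + (σ * Real.tan α * c : ℝ) * Complex.I)) t := by
    refine HasDerivAt.congr_of_eventuallyEq ?_ hγ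
    rw [hγ.self_of_nhds, mul_assoc]
    exact ((hf.neg.ofReal_comp.add
      ((hf.const_mul (σ * Real.tan α)).ofReal_comp.mul_const Complex.I)).cexp).const_mul p
  refine ⟨hd.differentiableAt, ?_⟩
  rw [hd.deriv]
  refine angle_spiral_tangent_le h0 h1 hσ hc ?_
  rw [hγ.self_of_nhds]
  exact mul_ne_zero hp (Complex.exp_ne_zero _)

theorem exists_spiralArc {α : ℝ} (h0 : 0 < α) (h1 : α < Real.pi / 2) {x y : ℝ × ℝ} (hxy : y < x) :
    ∃ γ, IsSpiralArc α γ (spiralPoint α x) (spiralPoint α y) := by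
  have htan : 0 < Real.tan α := Real.tan_pos_of_pos_of_lt_pi_div_two h0 h1
  have hle := hxy.le
  obtain ⟨hl1, hl2⟩ : y.1 ≤ x.1 ∧ y.2 ≤ x.2 := hle
  set A := x.1 - y.1 with hA
  set B := x.2 - y.2 with hB
  have hD : 0 < A + B := by
    rcases Prod.lt_iff.1 hxy with ⟨h, h'⟩ | ⟨h, h'⟩ <;> linarith
  set D := A + B with hDdef
  -- Lower the first coordinate from `x.1` to `y.1` until `t = A / D`, then the second: a left
  -- spiral followed by a right one. Either part may be degenerate.
  set γ : ℝ → ℂ := fun t =>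
    spiralPoint α (max y.1 (x.1 - D * t), min x.2 (x.2 + A - D * t)) with hγ
  set f : ℝ → ℝ := fun t => D * t / (2 * Real.tan α) with hf
  have hfd : ∀ t, HasDerivAt f (D / (2 * Real.tan α)) t := fun t => by
    simpa using ((hasDerivAt_id t).const_mul D).div_const (2 * Real.tan α)
  have hleft : ∀ t, D * t ≤ A → γ t = spiralPoint α x * Complex.exp (((-(f t) : ℝ) : ℂ) +
      (((-1) * Real.tan α * f t : ℝ) : ℂ) * Complex.I) := by
    intro t ht
    simp only [hγ, hf]
    rw [max_eq_right (by linarith), min_eq_left (by linarith), spiralPoint, spiralPoint,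
      ← Complex.exp_add]
    congr 1
    apply Complex.ext <;>
    · simp only [Complex.add_re, Complex.mul_re, Complex.add_im, Complex.mul_im, Complex.ofReal_re,
        Complex.ofReal_im, Complex.I_re, Complex.I_im]
      field_simp
      ring
  have hright : ∀ t, A ≤ D * t → γ t = spiralPoint α (y.1, x.2 + A) *
      Complex.exp (((-(f t) : ℝ) : ℂ) + ((1 * Real.tan α * f t : ℝ) : ℂ) * Complex.I) := by
    intro t ht
    simp only [hγ, hf]
    rw [max_eq_left (by linarith), min_eq_right (by linarith), spiralPoint, spiralPoint,
      ← Complex.exp_add]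
    congr 1
    apply Complex.ext <;>
    · simp only [Complex.add_re, Complex.mul_re, Complex.add_im, Complex.mul_im, Complex.ofReal_re,
        Complex.ofReal_im, Complex.I_re, Complex.I_im]
      field_simp
      ring
  have hcont : Continuous γ := by
    simp only [hγ, spiralPoint]
    fun_prop
  refine ⟨γ, ⟨?_, ?_, hcont.continuousOn, {A / D}, ?_⟩, {A / D}, ?_⟩
  · simp only [hγ]
    congr 1
    ext
    · simp; linarith
    · simp; linarith
  · simp only [hγ]
    congr 1
    ext
    · simp; linarith
    · dsimp only
      rw [min_eq_right] <;> linarith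
  · intro t _ ht
    rw [Finset.mem_singleton] at ht
    have hDt : D * t ≠ A := fun h => ht (by rw [← h]; field_simp)
    rcases lt_or_gt_of_ne hDt with hlt | hgt
    · refine spiral_tangent h0 h1 (Or.inr rfl) (spiralPoint_ne_zero α x) (hfd t)
        (by positivity) ?_
      have : ∀ᶠ s in nhds t, D * s < A :=
        (continuous_const.mul continuous_id).tendsto t |>.eventually (gt_mem_nhds hlt)
      exact this.mono fun s hs => hleft s hs.le
    · refine spiral_tangent h0 h1 (Or.inl rfl) (spiralPoint_ne_zero α (y.1, x.2 + A)) (hfd t)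
        (by positivity) ?_
      have : ∀ᶠ s in nhds t, A < D * s :=
        (continuous_const.mul continuous_id).tendsto t |>.eventually (lt_mem_nhds hgt)
      exact this.mono fun s hs => hright s hs.le
  · intro a b _ _ _ hS
    have hS' := hS _ (Finset.mem_singleton_self _)
    by_cases hb : b ≤ A / D
    · refine ⟨-1, _, Or.inr rfl, fun t ht => ⟨f t, hleft t ?_⟩⟩
      have := (ht.2.le.trans hb)
      rw [le_div_iff₀ hD] at this
      linarith
    · have ha : A / D ≤ a := by
        by_contra h
        exact hS' ⟨not_le.1 h, not_le.1 hb⟩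
      refine ⟨1, _, Or.inl rfl, fun t ht => ⟨f t, hright t ?_⟩⟩
      have := ha.trans ht.1.le
      rw [div_le_iff₀ hD] at this
      linarith

theorem exists_spiralArc_to_root {α : ℝ} (h0 : 0 < α) (h1 : α < Real.pi / 2) {p : ℂ}
    (hp : p ≠ 0) : ∃ γ, IsSpiralArc α γ p 0 := by
  -- The spiral reaches the root only after infinite time; this reparametrisation makes the radius
  -- decrease linearly to `0` on `[0, 1]`. At `t = 1` the factor `1 - t` makes the value of the
  -- logarithm irrelevant.
  set f : ℝ → ℝ := fun t => -Real.log (1 - t) with hf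
  set γ : ℝ → ℂ := fun t => p * (((1 - t : ℝ) : ℂ) *
    Complex.exp (((1 * Real.tan α * f t : ℝ) : ℂ) * Complex.I)) with hγ
  have hform : ∀ t, t < 1 → γ t = p * Complex.exp (((-(f t) : ℝ) : ℂ) +
      ((1 * Real.tan α * f t : ℝ) : ℂ) * Complex.I) := by
    intro t ht
    simp only [hγ]
    rw [Complex.exp_add, ← Complex.ofReal_exp]
    simp only [hf, neg_neg]
    rw [Real.exp_log (by linarith)]
  have hfd : ∀ t, t < 1 → HasDerivAt f (1 / (1 - t)) t := fun t ht => by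
    have h2 : HasDerivAt (fun t : ℝ => 1 - t) (-1) t := by
      simpa using (hasDerivAt_id t).const_sub 1
    exact (h2.log (by linarith)).neg.congr_deriv (by rw [neg_div, neg_neg])
  refine ⟨γ, ⟨by simp [hγ, hf], by simp [hγ], ?_, ∅, ?_⟩, ∅, ?_⟩
  · intro t ht
    rcases ht.2.lt_or_eq with hlt | rfl
    · have hp' := spiral_tangent h0 h1 (Or.inl rfl) hp (hfd t hlt)
        (by have := sub_pos.2 hlt; positivity)
        ((gt_mem_nhds hlt).mono fun s hs => hform s hs)
      exact hp'.1.continuousAt.continuousWithinAt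
    · refine ContinuousAt.continuousWithinAt ?_
      rw [ContinuousAt, show γ 1 = 0 by simp [hγ], tendsto_zero_iff_norm_tendsto_zero]
      have : (fun t => ‖γ t‖) = fun t => ‖p‖ * |1 - t| := by
        ext t
        simp only [hγ]
        rw [norm_mul, norm_mul, Complex.norm_exp_ofReal_mul_I, mul_one, Complex.norm_real,
          Real.norm_eq_abs]
      rw [this]
      have hc : Continuous fun t : ℝ => ‖p‖ * |1 - t| := by fun_prop
      simpa using hc.tendsto 1
  · intro t ht _
    exact spiral_tangent h0 h1 (Or.inl rfl) hp (hfd t ht.2)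
      (by have := sub_pos.2 ht.2; positivity)
      ((gt_mem_nhds ht.2).mono fun s hs => hform s hs)
  · intro a b _ _ hb _
    exact ⟨1, p, Or.inl rfl, fun t ht => ⟨f t, hform t (ht.2.trans_le hb)⟩⟩

/-! ### The cost of joining two points -/

theorem spiralRadius_pos (α : ℝ) (x : ℝ × ℝ) : 0 < spiralRadius α x := Real.exp_pos _

theorem spiralRadius_mono {α : ℝ} (ht : 0 < Real.tan α) {x y : ℝ × ℝ} (h : x ≤ y) :
    spiralRadius α x ≤ spiralRadius α y := by
  have h1 := h.1
  have h2 := h.2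
  unfold spiralRadius
  gcongr

/-- By monotonicity `z` may be replaced by `u ⊔ w`. With the radius of the meet factored out, the
claim becomes `(exp A - 1) * (exp B - 1) ≥ 0`: the exponential of a modular function is
supermodular. -/
theorem spiralRadius_add_le {α : ℝ} (ht : 0 < Real.tan α) {u w z : ℝ × ℝ} (hu : u ≤ z)
    (hw : w ≤ z) :
    spiralRadius α u + spiralRadius α w ≤ spiralRadius α z + spiralRadius α (u ⊓ w) := by
  refine le_trans ?_ (add_le_add_left (spiralRadius_mono ht (sup_le hu hw)) _)
  have hA := Real.one_le_exp (x := ((u.1 + u.2) - ((u ⊓ w).1 + (u ⊓ w).2)) / (2 * Real.tan α))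
    (div_nonneg (sub_nonneg.2 (add_le_add inf_le_left inf_le_left)) (by positivity))
  have hB := Real.one_le_exp (x := ((w.1 + w.2) - ((u ⊓ w).1 + (u ⊓ w).2)) / (2 * Real.tan α))
    (div_nonneg (sub_nonneg.2 (add_le_add inf_le_right inf_le_right)) (by positivity))
  set A := ((u.1 + u.2) - ((u ⊓ w).1 + (u ⊓ w).2)) / (2 * Real.tan α) with hAdef
  set B := ((w.1 + w.2) - ((u ⊓ w).1 + (u ⊓ w).2)) / (2 * Real.tan α) with hBdef
  have e1 : spiralRadius α u = spiralRadius α (u ⊓ w) * Real.exp A := by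
    unfold spiralRadius
    rw [← Real.exp_add, hAdef]
    congr 1
    ring
  have e2 : spiralRadius α w = spiralRadius α (u ⊓ w) * Real.exp B := by
    unfold spiralRadius
    rw [← Real.exp_add, hBdef]
    congr 1
    ring
  have e3 : spiralRadius α (u ⊔ w) = spiralRadius α (u ⊓ w) * (Real.exp A * Real.exp B) := by
    unfold spiralRadius
    rw [← Real.exp_add, ← Real.exp_add, hAdef, hBdef, ← add_div, ← add_div]
    congr 2
    have m1 : (u ⊓ w).1 + (u ⊔ w).1 = u.1 + w.1 := min_add_max _ _
    have m2 : (u ⊓ w).2 + (u ⊔ w).2 = u.2 + w.2 := min_add_max _ _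
    linarith
  rw [e1, e2, e3]
  have := mul_nonneg (spiralRadius_pos α (u ⊓ w)).le
    (mul_nonneg (sub_nonneg.2 hA) (sub_nonneg.2 hB))
  linarith

/-- The decrease of the distance to the root along the two spirals that join `x` and `y`. -/
noncomputable def joinCost (α : ℝ) (x y : ℝ × ℝ) : ℝ :=
  spiralRadius α x + spiralRadius α y - 2 * spiralRadius α (x ⊓ y)

theorem joinCost_comm (α : ℝ) (x y : ℝ × ℝ) : joinCost α x y = joinCost α y x := by
  rw [joinCost, joinCost, inf_comm]
  ring

theorem joinCost_nonneg {α : ℝ} (ht : 0 < Real.tan α) (x y : ℝ × ℝ) : 0 ≤ joinCost α x y := by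
  unfold joinCost
  linarith [spiralRadius_mono ht (inf_le_left : x ⊓ y ≤ x),
    spiralRadius_mono ht (inf_le_right : x ⊓ y ≤ y)]

/-- `exp t * (1 - sin t)` starts at `1` and decreases on `[0, π/2]`, because `sin t + cos t ≥ 1`
there. -/
theorem one_sub_exp_neg_le_sin {b : ℝ} (h0 : 0 ≤ b) (h1 : b ≤ Real.pi / 2) :
    1 - Real.exp (-b) ≤ Real.sin b := by
  have hanti : AntitoneOn (fun t => Real.exp t * (1 - Real.sin t)) (Set.Icc 0 (Real.pi / 2)) := by
    refine antitoneOn_of_deriv_nonpos (convex_Icc _ _) (by fun_prop) (by fun_prop) fun t ht => ?_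
    rw [interior_Icc] at ht
    have hd : HasDerivAt (fun t => Real.exp t * (1 - Real.sin t)) _ t :=
      (Real.hasDerivAt_exp t).mul ((Real.hasDerivAt_sin t).const_sub 1)
    rw [hd.deriv]
    have hs : 0 ≤ Real.sin t := Real.sin_nonneg_of_nonneg_of_le_pi ht.1.le (by linarith [ht.2])
    have hc : 0 ≤ Real.cos t := Real.cos_nonneg_of_neg_pi_div_two_le_of_le (by linarith [ht.1])
      ht.2.le
    have hsc := Real.sin_sq_add_cos_sq t
    have h3 : 1 ≤ Real.sin t + Real.cos t := by nlinarith [mul_nonneg hs hc]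
    have := mul_nonneg (Real.exp_pos t).le (sub_nonneg.2 h3)
    linarith
  have h := hanti (Set.left_mem_Icc.2 (h0.trans h1)) ⟨h0, h1⟩ h0
  simp only [Real.exp_zero, Real.sin_zero, sub_zero, mul_one] at h
  have h2 : 1 - Real.sin b ≤ Real.exp (-b) := by
    rw [Real.exp_neg, ← one_div, le_div_iff₀ (Real.exp_pos b)]
    linarith
  linarith

/-- Bernoulli's inequality for `exp (-b) ^ K` with `K = max 1 c` reduces this to `c = 1`. -/
theorem one_sub_exp_neg_mul_le {b c : ℝ} (h0 : 0 ≤ b) (h1 : b ≤ Real.pi / 2) :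
    1 - Real.exp (-(c * b)) ≤ max 1 c * Real.sin b := by
  have hsin := one_sub_exp_neg_le_sin h0 h1
  set K := max 1 c with hK
  have hK1 : 1 ≤ K := le_max_left _ _
  have h2 : Real.exp (-(K * b)) ≤ Real.exp (-(c * b)) := by
    have : c ≤ K := le_max_right _ _
    gcongr
  have h3 := one_add_mul_self_le_rpow_one_add (s := Real.exp (-b) - 1)
    (by linarith [Real.exp_pos (-b)]) hK1
  rw [add_sub_cancel, ← Real.exp_mul, neg_mul, mul_comm b K] at h3
  have h4 := mul_le_mul_of_nonneg_left hsin (zero_le_one.trans hK1)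
  linarith

theorem spiralPoint_re (α : ℝ) (x : ℝ × ℝ) :
    (spiralPoint α x).re = spiralRadius α x * Real.cos ((x.1 - x.2) / 2) := by
  rw [spiralPoint, Complex.exp_add, ← Complex.ofReal_exp, Complex.re_ofReal_mul,
    Complex.exp_ofReal_mul_I_re, spiralRadius]

theorem spiralPoint_im (α : ℝ) (x : ℝ × ℝ) :
    (spiralPoint α x).im = spiralRadius α x * Real.sin ((x.1 - x.2) / 2) := by
  rw [spiralPoint, Complex.exp_add, ← Complex.ofReal_exp, Complex.im_ofReal_mul,
    Complex.exp_ofReal_mul_I_im, spiralRadius]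

theorem dist_sq_spiralPoint (α : ℝ) (x y : ℝ × ℝ) :
    dist (spiralPoint α x) (spiralPoint α y) ^ 2 =
      (spiralRadius α x - spiralRadius α y) ^ 2 + 4 * spiralRadius α x * spiralRadius α y *
        Real.sin (((y.1 - y.2) / 2 - (x.1 - x.2) / 2) / 2) ^ 2 := by
  have h1 : Real.cos ((y.1 - y.2) / 2 - (x.1 - x.2) / 2) =
      1 - 2 * Real.sin (((y.1 - y.2) / 2 - (x.1 - x.2) / 2) / 2) ^ 2 := by
    rw [← Real.cos_two_mul_eq_one_sub]
    congr 1
    ring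
  rw [Real.cos_sub] at h1
  rw [dist_eq_norm, Complex.sq_norm, Complex.normSq_apply, Complex.sub_re, Complex.sub_im,
    spiralPoint_re, spiralPoint_re, spiralPoint_im, spiralPoint_im]
  have hx := Real.sin_sq_add_cos_sq ((x.1 - x.2) / 2)
  have hy := Real.sin_sq_add_cos_sq ((y.1 - y.2) / 2)
  linear_combination spiralRadius α x ^ 2 * hx + spiralRadius α y ^ 2 * hy -
    2 * spiralRadius α x * spiralRadius α y * h1

/-- With `r²` and `s²` the two radii and `b` half the angle between the points, the cost is `(r -
s)² + 2rs(1 - exp (-b cot α))`. The two terms are compared with the legs `|r² - s²|` and `2rs sin b`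
of a right triangle whose hypotenuse is the distance. -/
theorem joinCost_le_of_incomparable {α : ℝ} (ht : 0 < Real.tan α) {x y : ℝ × ℝ}
    (h1 : x.1 ≤ y.1) (h2 : y.2 ≤ x.2) (hπ : (y.1 - y.2) / 2 - (x.1 - x.2) / 2 ≤ Real.pi) :
    joinCost α x y ≤
      3 / 2 * max 1 (1 / Real.tan α) * dist (spiralPoint α x) (spiralPoint α y) := by
  have hinf : x ⊓ y = (x.1, y.2) := Prod.ext (inf_eq_left.2 h1) (inf_eq_right.2 h2)
  set b := ((y.1 - y.2) / 2 - (x.1 - x.2) / 2) / 2 with hb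
  have hb0 : 0 ≤ b := by rw [hb]; linarith
  have hb1 : b ≤ Real.pi / 2 := by rw [hb]; linarith
  have hsb : 0 ≤ Real.sin b := Real.sin_nonneg_of_nonneg_of_le_pi hb0 (by linarith [Real.pi_pos])
  have hN := dist_sq_spiralPoint α x y
  rw [← hb] at hN
  set N := dist (spiralPoint α x) (spiralPoint α y)
  have hN0 : 0 ≤ N := dist_nonneg
  set r := Real.exp ((x.1 + x.2) / (2 * Real.tan α) / 2)
  set s := Real.exp ((y.1 + y.2) / (2 * Real.tan α) / 2)
  have hr : 0 < r := Real.exp_pos _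
  have hs : 0 < s := Real.exp_pos _
  have er : spiralRadius α x = r ^ 2 := by
    rw [spiralRadius, ← Real.exp_nat_mul]
    congr 1
    push_cast
    ring
  have es : spiralRadius α y = s ^ 2 := by
    rw [spiralRadius, ← Real.exp_nat_mul]
    congr 1
    push_cast
    ring
  have ej : spiralRadius α (x ⊓ y) = r * s * Real.exp (-(1 / Real.tan α * b)) := by
    rw [hinf, spiralRadius, ← Real.exp_add, ← Real.exp_add, hb]
    congr 1
    field_simp
    ring
  have hexp := one_sub_exp_neg_mul_le (c := 1 / Real.tan α) hb0 hb1
  set K := max 1 (1 / Real.tan α)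
  have hK : 1 ≤ K := le_max_left _ _
  rw [joinCost, er, es, ej]
  rw [er, es] at hN
  have hX : (r - s) ^ 2 ≤ |r ^ 2 - s ^ 2| := by
    rw [sq_sub_sq, abs_mul, abs_of_pos (by positivity : 0 < r + s), ← sq_abs, sq]
    gcongr
    exact abs_sub_le_iff.2 ⟨by linarith, by linarith⟩
  have hY := mul_le_mul_of_nonneg_left hexp (by positivity : 0 ≤ 2 * (r * s))
  have hXK : |r ^ 2 - s ^ 2| ≤ K * |r ^ 2 - s ^ 2| := le_mul_of_one_le_left (abs_nonneg _) hK
  -- The sum of the legs is at most `√2` times the hypotenuse, and `√2 ≤ 3/2`.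
  have hsum : |r ^ 2 - s ^ 2| + 2 * (r * s) * Real.sin b ≤ 3 / 2 * N := by
    refine abs_le_of_sq_le_sq' ?_ (by positivity) |>.2
    have hq : |r ^ 2 - s ^ 2| ^ 2 = (r ^ 2 - s ^ 2) ^ 2 := sq_abs _
    nlinarith [sq_nonneg (|r ^ 2 - s ^ 2| - 2 * (r * s) * Real.sin b), sq_nonneg N]
  have := mul_le_mul_of_nonneg_left hsum (zero_le_one.trans hK)
  linarith

theorem joinCost_le_of_le {α : ℝ} {x y : ℝ × ℝ} (h : x ≤ y) :
    joinCost α x y ≤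
      3 / 2 * max 1 (1 / Real.tan α) * dist (spiralPoint α x) (spiralPoint α y) := by
  have hK : (1 : ℝ) ≤ max 1 (1 / Real.tan α) := le_max_left _ _
  have h1 : joinCost α x y ≤ dist (spiralPoint α x) (spiralPoint α y) := by
    rw [joinCost, inf_eq_left.2 h, dist_comm, dist_eq_norm, ← norm_spiralPoint, ← norm_spiralPoint]
    linarith [norm_sub_norm_le (spiralPoint α y) (spiralPoint α x)]
  exact h1.trans (le_mul_of_one_le_left dist_nonneg (by linarith))

theorem joinCost_le {α : ℝ} (ht : 0 < Real.tan α) {x y : ℝ × ℝ}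
    (hπ : |(y.1 - y.2) / 2 - (x.1 - x.2) / 2| ≤ Real.pi) :
    joinCost α x y ≤
      3 / 2 * max 1 (1 / Real.tan α) * dist (spiralPoint α x) (spiralPoint α y) := by
  obtain ⟨hπ1, hπ2⟩ := abs_le.1 hπ
  rcases le_total x.1 y.1 with h1 | h1 <;> rcases le_total x.2 y.2 with h2 | h2
  · exact joinCost_le_of_le ⟨h1, h2⟩
  · exact joinCost_le_of_incomparable ht h1 h2 hπ2
  · rw [joinCost_comm, dist_comm]
    exact joinCost_le_of_incomparable ht h1 h2 (by linarith)
  · rw [joinCost_comm, dist_comm]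
    exact joinCost_le_of_le ⟨h1, h2⟩

/-- Rotating by `-φ` before taking the principal argument selects the lift whose angle is within `π`
of that of `x`. -/
theorem exists_spiralPoint_eq {α : ℝ} (ht : 0 < Real.tan α) (x : ℝ × ℝ) (z : ℂ) (hz : z ≠ 0) :
    ∃ y, spiralPoint α y = z ∧ |(y.1 - y.2) / 2 - (x.1 - x.2) / 2| ≤ Real.pi := by
  set φ := (x.1 - x.2) / 2
  set w := z * Complex.exp ((-φ : ℝ) * Complex.I) with hw
  have hwz : ‖w‖ = ‖z‖ := by
    rw [hw, norm_mul, Complex.norm_exp_ofReal_mul_I, mul_one]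
  refine ⟨(Real.tan α * Real.log ‖z‖ + (φ + w.arg), Real.tan α * Real.log ‖z‖ - (φ + w.arg)),
    ?_, ?_⟩
  · have e1 : (Real.tan α * Real.log ‖z‖ + (φ + w.arg) +
        (Real.tan α * Real.log ‖z‖ - (φ + w.arg))) / (2 * Real.tan α) = Real.log ‖z‖ := by
      field_simp
      ring
    have e2 : (Real.tan α * Real.log ‖z‖ + (φ + w.arg) -
        (Real.tan α * Real.log ‖z‖ - (φ + w.arg))) / 2 = w.arg + φ := by
      ring
    simp only [spiralPoint, e1, e2]
    rw [Complex.exp_add, ← Complex.ofReal_exp, Real.exp_log (norm_pos_iff.2 hz), ← hwz,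
      Complex.ofReal_add, add_mul, Complex.exp_add, ← mul_assoc, Complex.norm_mul_exp_arg_mul_I,
      hw, mul_assoc, ← Complex.exp_add]
    simp
  · have e2 : (Real.tan α * Real.log ‖z‖ + (φ + w.arg) -
        (Real.tan α * Real.log ‖z‖ - (φ + w.arg))) / 2 - φ = w.arg := by
      ring
    simp only [e2]
    exact Complex.abs_arg_le_pi w

theorem exists_spiralPoint_lift {α : ℝ} (ht : 0 < Real.tan α) (q : ℕ → ℂ) (hq : ∀ m, q m ≠ 0) :
    ∃ p : ℕ → ℝ × ℝ, ∀ m, spiralPoint α (p m) = q m ∧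
      |((p (m + 1)).1 - (p (m + 1)).2) / 2 - ((p m).1 - (p m).2) / 2| ≤ Real.pi := by
  choose f hf using exists_spiralPoint_eq ht
  let p : ℕ → ℝ × ℝ := fun m => Nat.rec (f 0 (q 0) (hq 0)) (fun m x => f x (q (m + 1)) (hq _)) m
  refine ⟨p, fun m => ⟨?_, (hf (p m) (q (m + 1)) (hq _)).2⟩⟩
  cases m with
  | zero => exact (hf 0 (q 0) (hq 0)).1
  | succ m => exact (hf (p m) (q (m + 1)) (hq _)).1

/-! ### Joining the points of a path by repeated halving -/

/-- Appending `p (j + 1)` lowers the meet from `J` to `J ⊓ p (j + 1)`. By supermodularity the radius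
drops no more than from `p j` to `p j ⊓ p (j + 1)`, which the new join cost covers. -/
theorem exists_isGLB_path {α : ℝ} (ht : 0 < Real.tan α) (p : ℕ → ℝ × ℝ) {i j : ℕ} (hij : i ≤ j) :
    ∃ J, IsGLB (p '' Set.Icc i j) J ∧
      spiralRadius α (p i) - spiralRadius α J ≤
        ∑ m ∈ Finset.Ico i j, joinCost α (p m) (p (m + 1)) ∧
      spiralRadius α (p j) - spiralRadius α J ≤
        ∑ m ∈ Finset.Ico i j, joinCost α (p m) (p (m + 1)) := by
  induction j, hij using Nat.le_induction with
  | base => exact ⟨p i, by simp, by simp, by simp⟩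
  | succ j hij ih =>
    obtain ⟨J, hJ, hhead, htail⟩ := ih
    have hJj : J ≤ p j := hJ.1 ⟨j, ⟨hij, le_rfl⟩, rfl⟩
    have hsuper := spiralRadius_add_le ht hJj (inf_le_left : p j ⊓ p (j + 1) ≤ p j)
    rw [← inf_assoc, inf_eq_left.2 hJj] at hsuper
    have hl := spiralRadius_mono ht (inf_le_left : p j ⊓ p (j + 1) ≤ p j)
    have hr := spiralRadius_mono ht (inf_le_right : p j ⊓ p (j + 1) ≤ p (j + 1))
    refine ⟨J ⊓ p (j + 1), ?_, ?_, ?_⟩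
    · have himage : p '' Set.Icc i (j + 1) = p '' Set.Icc i j ∪ {p (j + 1)} := by
        rw [← Set.image_singleton, ← Set.image_union]
        congr 1
        ext m
        simp only [Set.mem_Icc, Set.mem_union, Set.mem_singleton_iff]
        omega
      rw [himage]
      exact hJ.union isGLB_singleton
    · rw [Finset.sum_Ico_succ_top hij, joinCost]
      linarith
    · rw [Finset.sum_Ico_succ_top hij, joinCost]
      linarith

/-- Two uses of supermodularity bound the cost by that of the detour `J₁`, `p m`, `p (m + 1)`, `J₂`.
Its outer legs are a tail and a head bounded by `exists_isGLB_path`, over disjoint sets of steps. -/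
theorem joinCost_isGLB_le {α : ℝ} (ht : 0 < Real.tan α) (p : ℕ → ℝ × ℝ) {i m j : ℕ} (him : i ≤ m)
    (hmj : m + 1 ≤ j) {J₁ J₂ : ℝ × ℝ} (h₁ : IsGLB (p '' Set.Icc i m) J₁)
    (h₂ : IsGLB (p '' Set.Icc (m + 1) j) J₂) :
    joinCost α J₁ J₂ ≤ ∑ m ∈ Finset.Ico i j, joinCost α (p m) (p (m + 1)) := by
  obtain ⟨J, hJ, -, htail⟩ := exists_isGLB_path ht p him
  obtain ⟨J', hJ', hhead, -⟩ := exists_isGLB_path ht p hmj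
  obtain rfl := h₁.unique hJ
  obtain rfl := h₂.unique hJ'
  have hp : J₁ ≤ p m := h₁.1 ⟨m, ⟨him, le_rfl⟩, rfl⟩
  have hq : J₂ ≤ p (m + 1) := h₂.1 ⟨m + 1, ⟨le_rfl, hmj⟩, rfl⟩
  have s1 := spiralRadius_add_le ht hp (inf_le_left : p m ⊓ p (m + 1) ≤ p m)
  rw [← inf_assoc, inf_eq_left.2 hp] at s1
  have s2 := spiralRadius_add_le ht (inf_le_right : J₁ ⊓ p (m + 1) ≤ p (m + 1)) hq
  rw [inf_assoc, inf_eq_right.2 hq] at s2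
  rw [← Finset.sum_Ico_consecutive _ (him.trans m.le_succ) hmj, Finset.sum_Ico_succ_top him]
  unfold joinCost at *
  linarith

theorem sum_union_le_add {ι : Type*} [DecidableEq ι] {s t : Finset ι} {f : ι → ℝ}
    (h : ∀ i ∈ s, 0 ≤ f i) : ∑ i ∈ s ∪ t, f i ≤ ∑ i ∈ s, f i + ∑ i ∈ t, f i := by
  rw [← Finset.sum_union_inter]
  exact le_add_of_nonneg_right (Finset.sum_nonneg fun i hi => h i (Finset.mem_inter.1 hi).1)

/-- The edges `E` form a forest of spiral segments towards the common end `J`. -/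
def IsJoinForest (E : Finset ((ℝ × ℝ) × (ℝ × ℝ))) (J : ℝ × ℝ) : Prop :=
  ∀ e ∈ E, e.2 < e.1 ∧ J ≤ e.2 ∧ (e.2 = J ∨ ∃ e' ∈ E, e'.1 = e.2)

theorem IsJoinForest.exists_extend {α : ℝ} (ht : 0 < Real.tan α)
    {E : Finset ((ℝ × ℝ) × (ℝ × ℝ))} {J J' : ℝ × ℝ} (h : IsJoinForest E J) (hJ : J' ≤ J) :
    ∃ E', E ⊆ E' ∧ IsJoinForest E' J' ∧ (J = J' ∨ ∃ e ∈ E', e.1 = J) ∧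
      ∑ e ∈ E', (spiralRadius α e.1 - spiralRadius α e.2) ≤
        ∑ e ∈ E, (spiralRadius α e.1 - spiralRadius α e.2) +
          (spiralRadius α J - spiralRadius α J') := by
  classical
  rcases hJ.eq_or_lt with rfl | hlt
  · exact ⟨E, subset_rfl, h, Or.inl rfl, by simp⟩
  · refine ⟨{(J, J')} ∪ E, Finset.subset_union_right, ?_, Or.inr ⟨(J, J'), by simp, rfl⟩, ?_⟩
    · intro e he
      rcases Finset.mem_union.1 he with he | he
      · rw [Finset.mem_singleton.1 he]
        exact ⟨hlt, le_rfl, Or.inl rfl⟩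
      · obtain ⟨h1, h2, h3⟩ := h e he
        refine ⟨h1, hJ.trans h2, Or.inr ?_⟩
        rcases h3 with h3 | ⟨e', he', h3⟩
        · exact ⟨(J, J'), by simp, h3.symm⟩
        · exact ⟨e', Finset.mem_union_right _ he', h3⟩
    · rw [add_comm (∑ e ∈ E, _)]
      refine (sum_union_le_add fun e he => ?_).trans (by rw [Finset.sum_singleton])
      rw [Finset.mem_singleton.1 he, sub_nonneg]
      exact spiralRadius_mono ht hJ

theorem IsJoinForest.union [DecidableEq ((ℝ × ℝ) × (ℝ × ℝ))] {E₁ E₂ : Finset ((ℝ × ℝ) × (ℝ × ℝ))}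
    {J : ℝ × ℝ} (h₁ : IsJoinForest E₁ J) (h₂ : IsJoinForest E₂ J) : IsJoinForest (E₁ ∪ E₂) J := by
  intro e he
  rcases Finset.mem_union.1 he with he | he
  · obtain ⟨a, b, c⟩ := h₁ e he
    exact ⟨a, b, c.imp_right fun ⟨e', he', h⟩ => ⟨e', Finset.mem_union_left _ he', h⟩⟩
  · obtain ⟨a, b, c⟩ := h₂ e he
    exact ⟨a, b, c.imp_right fun ⟨e', he', h⟩ => ⟨e', Finset.mem_union_right _ he', h⟩⟩

theorem exists_joinForest {α : ℝ} (ht : 0 < Real.tan α) (p : ℕ → ℝ × ℝ) (k : ℕ) :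
    ∀ i j : ℕ, i ≤ j → j + 1 ≤ i + 2 ^ k → ∃ J E, IsGLB (p '' Set.Icc i j) J ∧ IsJoinForest E J ∧
      (∀ m ∈ Set.Icc i j, p m = J ∨ ∃ e ∈ E, e.1 = p m) ∧
      ∑ e ∈ E, (spiralRadius α e.1 - spiralRadius α e.2) ≤
        k * ∑ m ∈ Finset.Ico i j, joinCost α (p m) (p (m + 1)) := by
  classical
  induction k with
  | zero =>
    intro i j hij hk
    obtain rfl : i = j := by rw [pow_zero] at hk; omega
    refine ⟨p i, ∅, by simp, fun e he => absurd he (Finset.notMem_empty e), fun m hm => ?_, by simp⟩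
    rw [Set.Icc_self, Set.mem_singleton_iff] at hm
    exact Or.inl (hm ▸ rfl)
  | succ k ih =>
    intro i j hij hk
    have hnn : ∀ a b : ℕ, 0 ≤ ∑ m ∈ Finset.Ico a b, joinCost α (p m) (p (m + 1)) :=
      fun a b => Finset.sum_nonneg fun m _ => joinCost_nonneg ht _ _
    by_cases hsmall : j + 1 ≤ i + 2 ^ k
    · obtain ⟨J, E, h1, h2, h3, h4⟩ := ih i j hij hsmall
      refine ⟨J, E, h1, h2, h3, h4.trans ?_⟩
      push_cast
      linarith [hnn i j]
    · have hpow : 1 ≤ 2 ^ k := Nat.one_le_two_pow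
      rw [pow_succ] at hk
      -- The left block `i, …, m` has exactly `2 ^ k` points and the right block at most that many.
      obtain ⟨m, hm⟩ : ∃ m, m + 1 = i + 2 ^ k := ⟨i + 2 ^ k - 1, by omega⟩
      have him : i ≤ m := by omega
      have hmj : m + 1 ≤ j := by omega
      obtain ⟨J₁, E₁, hG₁, hF₁, hM₁, hC₁⟩ := ih i m him (by omega)
      obtain ⟨J₂, E₂, hG₂, hF₂, hM₂, hC₂⟩ := ih (m + 1) j hmj (by omega)
      obtain ⟨E₁', hE₁, hF₁', hJ₁, hC₁'⟩ := hF₁.exists_extend ht (inf_le_left : J₁ ⊓ J₂ ≤ J₁)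
      obtain ⟨E₂', hE₂, hF₂', hJ₂, hC₂'⟩ := hF₂.exists_extend ht (inf_le_right : J₁ ⊓ J₂ ≤ J₂)
      refine ⟨J₁ ⊓ J₂, E₁' ∪ E₂', ?_, hF₁'.union hF₂', ?_, ?_⟩
      · have himage : p '' Set.Icc i j = p '' Set.Icc i m ∪ p '' Set.Icc (m + 1) j := by
          rw [← Set.image_union]
          congr 1
          ext n
          simp only [Set.mem_Icc, Set.mem_union]
          omega
        rw [himage]
        exact hG₁.union hG₂
      · intro n hn
        by_cases hnm : n ≤ m
        · rcases hM₁ n ⟨hn.1, hnm⟩ with h | ⟨e, he, h⟩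
          · rw [h]
            exact hJ₁.imp_right fun ⟨e, he, h⟩ => ⟨e, Finset.mem_union_left _ he, h⟩
          · exact Or.inr ⟨e, Finset.mem_union_left _ (hE₁ he), h⟩
        · rcases hM₂ n ⟨by omega, hn.2⟩ with h | ⟨e, he, h⟩
          · rw [h]
            exact hJ₂.imp_right fun ⟨e, he, h⟩ => ⟨e, Finset.mem_union_right _ he, h⟩
          · exact Or.inr ⟨e, Finset.mem_union_right _ (hE₂ he), h⟩
      · have hjoin := joinCost_isGLB_le ht p him hmj hG₁ hG₂
        have hU := sum_union_le_add (s := E₁') (t := E₂')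
          (f := fun e => spiralRadius α e.1 - spiralRadius α e.2)
          fun e he => sub_nonneg.2 (spiralRadius_mono ht (hF₁' e he).1.le)
        have hsplit : ∑ m ∈ Finset.Ico i m, joinCost α (p m) (p (m + 1)) +
            ∑ m ∈ Finset.Ico (m + 1) j, joinCost α (p m) (p (m + 1)) ≤
            ∑ m ∈ Finset.Ico i j, joinCost α (p m) (p (m + 1)) := by
          rw [← Finset.sum_Ico_consecutive _ (him.trans m.le_succ) hmj,
            Finset.sum_Ico_succ_top him]
          linarith [joinCost_nonneg ht (p m) (p (m + 1))]
        have hmul := mul_le_mul_of_nonneg_left hsplit (Nat.cast_nonneg (α := ℝ) k)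
        unfold joinCost at hjoin
        unfold joinCost at hmul hC₁ hC₂ ⊢
        push_cast
        linarith

/-! ### Short tours -/

/-- The length of the polygonal path through the points of a list. -/
noncomputable def pathLength {X : Type*} [PseudoMetricSpace X] : List X → ℝ
  | [] => 0
  | [_] => 0
  | x :: y :: l => dist x y + pathLength (y :: l)

/-- Visiting `u` by the excursion from `w` to `u` and back costs twice the edge; the triangle
inequality shortcuts the return. -/
theorem pathLength_insert_le {X : Type*} [PseudoMetricSpace X] (w u : X) (l₂ : List X) :
    ∀ l₁ : List X, pathLength (l₁ ++ w :: u :: l₂) ≤ pathLength (l₁ ++ w :: l₂) + 2 * dist w u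
  | [] => by
    have := dist_nonneg (x := w) (y := u)
    cases l₂ with
    | nil =>
      simp only [List.nil_append, pathLength]
      linarith
    | cons y l₂ =>
      simp only [List.nil_append, pathLength]
      linarith [dist_triangle u w y, dist_comm w u]
  | [a] => by
    have := pathLength_insert_le w u l₂ []
    simp only [List.nil_append, List.cons_append, pathLength] at this ⊢
    linarith
  | a :: b :: l₁ => by
    have := pathLength_insert_le w u l₂ (b :: l₁)
    simp only [List.cons_append, pathLength] at this ⊢
    linarith

theorem pathLength_eq_sum {X : Type*} [PseudoMetricSpace X] (x₀ : X) :
    ∀ l : List X, pathLength l =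
      ∑ m ∈ Finset.range (l.length - 1), dist (l.getD m x₀) (l.getD (m + 1) x₀)
  | [] => by simp [pathLength]
  | [_] => by simp [pathLength]
  | x :: y :: l => by
    have := pathLength_eq_sum x₀ (y :: l)
    rw [pathLength, this]
    simp only [List.length_cons, Nat.add_sub_cancel]
    rw [Finset.sum_range_succ']
    simp only [List.getD_cons_succ, List.getD_cons_zero]
    rw [add_comm]

theorem pathLength_map_val {Q : Finset ℂ} :
    ∀ l : List Q, pathLength (l.map Subtype.val) = pathLength l
  | [] => rfl
  | [_] => rfl
  | x :: y :: l => by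
    have := pathLength_map_val (y :: l)
    simp only [List.map_cons, pathLength] at this ⊢
    rw [this]
    rfl

/-- Grow the tour as in Prim's algorithm, without minimality: some edge of the connected graph
leaves the visited set, and its new end is inserted right after its old end. -/
theorem exists_partial_tour {X : Type*} [Fintype X] [PseudoMetricSpace X] {G : SimpleGraph X}
    (hG : G.Connected) {w : Sym2 X → ℝ} (hw : ∀ x y, w s(x, y) = dist x y) (r : X) (k : ℕ) :
    k + 1 ≤ Fintype.card X → ∃ (l : List X) (A : Finset (Sym2 X)), l.length = k ∧
      (r :: l).Nodup ∧ (∀ e ∈ A, e ∈ G.edgeSet ∧ ∀ x ∈ e, x ∈ r :: l) ∧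
      pathLength (r :: l) ≤ 2 * ∑ e ∈ A, w e := by
  classical
  induction k with
  | zero => exact fun _ => ⟨[], ∅, rfl, by simp, by simp, by simp [pathLength]⟩
  | succ k ih =>
    intro hk
    obtain ⟨l, A, hl, hnd, hA, hlen⟩ := ih (by omega)
    obtain ⟨v, hv⟩ : ∃ v, v ∉ r :: l := by
      by_contra! hall
      have h1 : Fintype.card X ≤ (r :: l).toFinset.card := by
        rw [← Finset.card_univ]
        exact Finset.card_le_card fun x _ => List.mem_toFinset.2 (hall x)
      have h2 := List.toFinset_card_le (r :: l)
      rw [List.length_cons, hl] at h2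
      omega
    obtain ⟨P⟩ := hG.preconnected r v
    obtain ⟨d, -, hd1, hd2⟩ := P.exists_boundary_dart {x | x ∈ r :: l} (by simp) hv
    have hadj := d.adj
    set a := d.fst
    set u := d.snd
    rw [Set.mem_ofPred_eq] at hd1 hd2
    obtain ⟨l₁, l₂, hsplit⟩ := List.mem_iff_append.1 hd1
    obtain ⟨l', hl'⟩ : ∃ l', l₁ ++ a :: u :: l₂ = r :: l' := by
      cases l₁ with
      | nil =>
        rw [List.nil_append, List.cons.injEq] at hsplit
        exact ⟨u :: l₂, by rw [hsplit.1]; rfl⟩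
      | cons b l₁ =>
        rw [List.cons_append, List.cons.injEq] at hsplit
        exact ⟨l₁ ++ a :: u :: l₂, by rw [hsplit.1]; rfl⟩
    have hperm : (r :: l').Perm (u :: r :: l) := by
      rw [← hl', hsplit]
      have := List.perm_middle (a := u) (l₁ := l₁ ++ [a]) (l₂ := l₂)
      simpa using this
    -- Each edge is charged only once, since the edges used so far have both ends in the old tour.
    have hnotin : s(a, u) ∉ A := fun h => hd2 ((hA _ h).2 u (Sym2.mem_mk_right a u))
    refine ⟨l', insert s(a, u) A, ?_, ?_, ?_, ?_⟩
    · have := hperm.length_eq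
      simp only [List.length_cons] at this
      omega
    · rw [hperm.nodup_iff, List.nodup_cons]
      exact ⟨hd2, hnd⟩
    · intro e he
      rcases Finset.mem_insert.1 he with rfl | he
      · refine ⟨hadj, fun x hx => hperm.mem_iff.2 ?_⟩
        rcases Sym2.mem_iff.1 hx with rfl | rfl
        · exact List.mem_cons_of_mem _ hd1
        · exact List.mem_cons_self
      · exact ⟨(hA e he).1, fun x hx => hperm.mem_iff.2 (List.mem_cons_of_mem _ ((hA e he).2 x hx))⟩
    · have := pathLength_insert_le a u l₂ l₁
      rw [← hsplit, hl'] at this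
      rw [Finset.sum_insert hnotin, hw]
      linarith

theorem exists_tour {Q : Finset ℂ} {G : SimpleGraph Q} (hG : G.Connected) (r : Q) :
    ∃ l : List Q, (r :: l).Nodup ∧ (∀ x, x ∈ r :: l) ∧
      pathLength (r :: l) ≤ 2 * graphLength G := by
  classical
  have hcard : 0 < Fintype.card Q := Fintype.card_pos_iff.2 ⟨r⟩
  set w : Sym2 Q → ℝ := Sym2.lift ⟨fun x y : Q => dist x y, fun x y => dist_comm x y⟩ with hw
  obtain ⟨l, A, hl, hnd, hA, hlen⟩ := exists_partial_tour hG (w := w) (fun _ _ => rfl) r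
    (Fintype.card Q - 1) (by omega)
  refine ⟨l, hnd, fun x => ?_, hlen.trans ?_⟩
  · have h1 : (r :: l).toFinset = Finset.univ := by
      refine Finset.eq_univ_of_card _ ?_
      rw [List.toFinset_card_of_nodup hnd, List.length_cons]
      omega
    exact List.mem_toFinset.1 (h1 ▸ Finset.mem_univ x)
  · refine mul_le_mul_of_nonneg_left ?_ zero_le_two
    unfold graphLength
    refine Finset.sum_le_sum_of_subset_of_nonneg (fun e he => ?_) fun e _ _ => ?_
    · exact SimpleGraph.mem_edgeFinset.2 (hA e he).1
    · induction e with
      | _ x y => exact dist_nonneg (x := x) (y := y)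

/-! ### Spiral trees from forests -/

/-- A point may start several edges of `E`, so one is chosen as its outgoing arc; dropping the
others only lowers the cost. The common end `J` gets one more spiral into the root, of radius drop
`spiralRadius α J`. Nodes are lifted points, with `none` as the root, so points that coincide in the
plane need not be identified. -/
theorem IsJoinForest.exists_spiralTree {α : ℝ} (h0 : 0 < α) (h1 : α < Real.pi / 2)
    {E : Finset ((ℝ × ℝ) × (ℝ × ℝ))} {J : ℝ × ℝ} (hE : IsJoinForest E J) {P : Finset ℂ}
    (hP : ∀ z ∈ P, z ≠ 0 → ∃ x, spiralPoint α x = z ∧ (x = J ∨ ∃ e ∈ E, e.1 = x)) :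
    ∃ T : FluxTree α P, T.IsSpiralTree ∧ T.length ≤ ENNReal.ofReal (1 / Real.cos α *
      (∑ e ∈ E, (spiralRadius α e.1 - spiralRadius α e.2) + spiralRadius α J)) := by
  classical
  have hcos : 0 < Real.cos α := Real.cos_pos_of_mem_Ioo ⟨by linarith, h1⟩
  have ht : 0 < Real.tan α := Real.tan_pos_of_pos_of_lt_pi_div_two h0 h1
  set N : Finset (ℝ × ℝ) := insert J (E.image Prod.fst) with hN
  have hmem : ∀ x, x ∈ N ↔ x = J ∨ ∃ e ∈ E, e.1 = x := fun x => by
    rw [hN, Finset.mem_insert, Finset.mem_image]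
  have hchoice : ∀ x : N, ∃ y : N, x.1 ≠ J → (x.1, y.1) ∈ E := by
    intro x
    by_cases hx : x.1 = J
    · exact ⟨x, fun h => absurd hx h⟩
    · obtain ⟨e, he, hex⟩ := ((hmem x.1).1 x.2).resolve_left hx
      refine ⟨⟨e.2, (hmem _).2 (hE e he).2.2⟩, fun _ => ?_⟩
      rw [← hex]
      exact he
  choose par hpar using hchoice
  have harc : ∀ x : N, ∃ γ, IsSpiralArc α γ (spiralPoint α x.1)
      (if x.1 = J then 0 else spiralPoint α (par x).1) := by
    intro x
    split_ifs with hx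
    · exact exists_spiralArc_to_root h0 h1 (spiralPoint_ne_zero α x.1)
    · exact exists_spiralArc h0 h1 (hE _ (hpar x hx)).1
  choose arc harc using harc
  let parent : Option N → Option N := fun v => v.bind fun x => if x.1 = J then none else some (par x)
  have hreach : ∀ x : N, ∃ k : ℕ, parent^[k] (some x) = none := by
    intro x
    induction x using WellFoundedLT.induction with
    | _ x ih =>
      by_cases hx : x.1 = J
      · exact ⟨1, by simp [parent, hx]⟩
      · obtain ⟨k, hk⟩ := ih (par x) (hE _ (hpar x hx)).1
        refine ⟨k + 1, ?_⟩
        rw [Function.iterate_succ_apply, show parent (some x) = some (par x) by simp [parent, hx]]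
        exact hk
  let T : FluxTree α P :=
    { Node := Option N
      fintypeNode := inferInstance
      root := none
      parent := parent
      pos := fun v => v.elim 0 fun x => spiralPoint α x.1
      arc := fun v => v.elim (fun _ => 0) arc
      pos_root := rfl
      parent_root := rfl
      reaches_root := fun v => by
        cases v with
        | none => exact ⟨0, rfl⟩
        | some x => exact hreach x
      terminal_mem := fun z hz => by
        by_cases hz0 : z = 0
        · exact ⟨none, hz0.symm⟩
        · obtain ⟨x, hx, hxE⟩ := hP z hz hz0
          exact ⟨some ⟨x, (hmem x).2 hxE⟩, hx⟩
      arc_restricted := fun v hv => by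
        cases v with
        | none => exact absurd rfl hv
        | some x =>
          have := (harc x).1
          by_cases hx : x.1 = J
          · simpa [parent, hx] using this
          · simpa [parent, hx] using this }
  refine ⟨T, ?_, ?_⟩
  · intro v hv
    cases v with
    | none => exact absurd rfl hv
    | some x =>
      have := harc x
      by_cases hx : x.1 = J
      · simpa [T, parent, hx] using this
      · simpa [T, parent, hx] using this
  -- Edges strictly descend and end above `J`, so none starts at `J` and its term stays separate in
  -- the sum.
  · have hJN : J ∉ E.image Prod.fst := by
      intro h
      obtain ⟨e, he, heJ⟩ := Finset.mem_image.1 h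
      obtain ⟨a, b, -⟩ := hE e he
      exact absurd (heJ ▸ a) (not_lt_of_ge b)
    let next : ℝ × ℝ → ℝ × ℝ := fun x => if h : x ∈ N then (par ⟨x, h⟩).1 else x
    let cost : ℝ × ℝ → ℝ := fun x =>
      if x = J then spiralRadius α J else spiralRadius α x - spiralRadius α (next x)
    have hnext : ∀ x ∈ E.image Prod.fst, (x, next x) ∈ E := by
      intro x hx
      have hxN : x ∈ N := Finset.mem_insert_of_mem hx
      simp only [next, dif_pos hxN]
      exact hpar ⟨x, hxN⟩ fun h => hJN (h ▸ hx)
    have hcostN : ∀ x ∈ N, 0 ≤ cost x := by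
      intro x hx
      simp only [cost]
      split_ifs with hxJ
      · exact (spiralRadius_pos α J).le
      · rw [sub_nonneg]
        exact spiralRadius_mono ht
          (hE _ (hnext x ((Finset.mem_insert.1 hx).resolve_left hxJ))).1.le
    have hsum : ∑ x ∈ N, cost x ≤
        ∑ e ∈ E, (spiralRadius α e.1 - spiralRadius α e.2) + spiralRadius α J := by
      rw [hN, Finset.sum_insert hJN, add_comm]
      have hcJ : cost J = spiralRadius α J := if_pos rfl
      rw [hcJ]
      gcongr
      calc ∑ x ∈ E.image Prod.fst, cost x
          = ∑ x ∈ E.image Prod.fst, (spiralRadius α x - spiralRadius α (next x)) :=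
            Finset.sum_congr rfl fun x hx => by
              have hxJ : x ≠ J := fun h => hJN (h ▸ hx)
              simp only [cost, if_neg hxJ]
        _ = ∑ e ∈ (E.image Prod.fst).image (fun x => (x, next x)),
              (spiralRadius α e.1 - spiralRadius α e.2) :=
            (Finset.sum_image (g := fun x => (x, next x))
              (f := fun e => spiralRadius α e.1 - spiralRadius α e.2) fun x _ y _ h =>
              (Prod.ext_iff.1 h).1).symm
        _ ≤ _ := by
            refine Finset.sum_le_sum_of_subset_of_nonneg (fun e he => ?_) fun e he _ =>
              sub_nonneg.2 (spiralRadius_mono ht (hE e he).1.le)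
            obtain ⟨x, hx, rfl⟩ := Finset.mem_image.1 he
            exact hnext x hx
    have harcLen : ∀ x : N, T.arcLength (some x) ≤ ENNReal.ofReal (1 / Real.cos α * cost x.1) := by
      intro x
      refine (T.arcLength_le h0 h1 (v := some x) (Option.some_ne_none x)).trans (le_of_eq ?_)
      congr 2
      by_cases hx : x.1 = J
      · simp [T, parent, hx, cost, norm_spiralPoint]
      · simp [T, parent, hx, cost, next, norm_spiralPoint]
    calc T.length ≤ ∑ x : N, T.arcLength (some x) := by
          refine le_trans (Finset.sum_le_sum_of_subset fun v hv => ?_)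
            (Finset.sum_map Finset.univ (Function.Embedding.some : N ↪ Option N) T.arcLength).le
          obtain ⟨x, rfl⟩ := Option.ne_none_iff_exists.1 ((@Finset.mem_filter _ _ (_) _ _).1 hv).2
          exact Finset.mem_map_of_mem _ (Finset.mem_univ x)
      _ ≤ ∑ x : N, ENNReal.ofReal (1 / Real.cos α * cost x.1) :=
          Finset.sum_le_sum fun x _ => harcLen x
      _ = ENNReal.ofReal (1 / Real.cos α * ∑ x ∈ N, cost x) := by
          rw [← ENNReal.ofReal_sum_of_nonneg fun x _ =>
            mul_nonneg (by positivity) (hcostN x.1 x.2), ← Finset.mul_sum,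
            Finset.sum_coe_sort N cost]
      _ ≤ _ := by
          refine ENNReal.ofReal_le_ofReal ?_
          gcongr

theorem one_div_cos_mul_max {α : ℝ} (h0 : 0 < α) (h1 : α < Real.pi / 2) :
    1 / Real.cos α * max 1 (1 / Real.tan α) = max (1 / Real.cos α) (1 / Real.sin α) := by
  have hcos : 0 < Real.cos α := Real.cos_pos_of_mem_Ioo ⟨by linarith, h1⟩
  have hsin : 0 < Real.sin α := Real.sin_pos_of_pos_of_lt_pi h0 (by linarith)
  rw [mul_max_of_nonneg _ _ (by positivity), mul_one, Real.tan_eq_sin_div_cos]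
  congr 1
  field_simp

theorem exists_spiralTree_length_le {α : ℝ} (h0 : 0 < α) (h1 : α < Real.pi / 2) {P : Finset ℂ}
    (hP : 2 ≤ P.card) {M : SimpleGraph (withRoot P)} (hM : M.Connected) :
    ∃ T : FluxTree α P, T.IsSpiralTree ∧
      T.length ≤ ENNReal.ofReal (3 * (⌈Real.logb 2 (P.card : ℝ)⌉ : ℝ) *
        max (1 / Real.cos α) (1 / Real.sin α) * graphLength M) := by
  classical
  have hcos : 0 < Real.cos α := Real.cos_pos_of_mem_Ioo ⟨by linarith, h1⟩
  have ht : 0 < Real.tan α := Real.tan_pos_of_pos_of_lt_pi_div_two h0 h1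
  have h0Q : (0 : ℂ) ∈ withRoot P := Finset.mem_insert_self _ _
  obtain ⟨l, hnd, hall, hlen⟩ := exists_tour hM ⟨0, h0Q⟩
  have hcard : l.length ≤ P.card := by
    have h2 : (⟨0, h0Q⟩ :: l).length ≤ Fintype.card (withRoot P) := hnd.length_le_card
    rw [Fintype.card_coe, List.length_cons] at h2
    have : (withRoot P).card ≤ P.card + 1 := by
      unfold withRoot
      exact Finset.card_insert_le _ _
    omega
  have hmeml : ∀ z ∈ P, z ≠ 0 → z ∈ l.map Subtype.val := by
    intro z hz hz0
    have h2 := hall ⟨z, Finset.mem_insert_of_mem hz⟩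
    rcases List.mem_cons.1 h2 with h2 | h2
    · exact absurd (congrArg Subtype.val h2) hz0
    · exact List.mem_map.2 ⟨_, h2, rfl⟩
  have hl0 : l.length ≠ 0 := by
    intro h
    rw [List.length_eq_zero_iff] at h
    subst h
    have : P ⊆ {0} := fun z hz => by
      by_contra hz0
      simpa using hmeml z hz (by simpa using hz0)
    have := Finset.card_le_card this
    rw [Finset.card_singleton] at this
    omega
  -- The default `1` only keeps `q` nonzero beyond the list, so that the whole sequence can be
  -- lifted.
  set q : ℕ → ℂ := fun m => (l.map Subtype.val).getD m 1 with hq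
  have hq0 : ∀ m, q m ≠ 0 := by
    intro m
    by_cases hm : m < l.length
    · simp only [hq]
      rw [List.getD_eq_getElem _ _ (by simpa using hm), List.getElem_map]
      intro h
      have h2 : l[m] = ⟨0, h0Q⟩ := Subtype.ext h
      exact (List.nodup_cons.1 hnd).1 (h2 ▸ List.getElem_mem hm)
    · simp only [hq]
      rw [List.getD_eq_default _ _ (by simpa using hm)]
      exact one_ne_zero
  obtain ⟨p, hp⟩ := exists_spiralPoint_lift ht q hq0
  set n := l.length with hn
  set k := Nat.clog 2 P.card with hk
  have hkn : n ≤ 2 ^ k := hcard.trans (Nat.le_pow_clog one_lt_two _)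
  obtain ⟨J, E, hJ, hE, hmem, hcost⟩ := exists_joinForest ht p k 0 (n - 1) (Nat.zero_le _) (by omega)
  obtain ⟨T, hT, hTlen⟩ := hE.exists_spiralTree h0 h1 (P := P) (by
    intro z hz hz0
    obtain ⟨m, hm, hzm⟩ := List.mem_iff_getElem.1 (hmeml z hz hz0)
    have hm' : m < n := by simpa using hm
    refine ⟨p m, ?_, hmem m ⟨Nat.zero_le _, by omega⟩⟩
    rw [(hp m).1, ← hzm]
    exact List.getD_eq_getElem _ _ hm)
  refine ⟨T, hT, hTlen.trans (ENNReal.ofReal_le_ofReal ?_)⟩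
  set K := max 1 (1 / Real.tan α) with hK
  have hK1 : 1 ≤ K := le_max_left _ _
  have hkc : (⌈Real.logb 2 (P.card : ℝ)⌉ : ℝ) = k := by
    have := Real.ceil_logb_natCast (b := 2) (r := P.card) (Nat.cast_nonneg _)
    rw [Int.clog_natCast] at this
    rw [hk]
    exact_mod_cast this
  have hk1 : (1 : ℝ) ≤ k := by
    have : 0 < Nat.clog 2 P.card := Nat.clog_pos one_lt_two hP
    exact_mod_cast this
  have hF : ∑ m ∈ Finset.Ico 0 (n - 1), joinCost α (p m) (p (m + 1)) ≤
      3 / 2 * K * pathLength l := by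
    rw [← pathLength_map_val, pathLength_eq_sum 1, List.length_map, Finset.mul_sum,
      ← Finset.range_eq_Ico]
    refine Finset.sum_le_sum fun m _ => ?_
    have := joinCost_le ht (hp m).2
    rw [(hp m).1, (hp (m + 1)).1] at this
    exact this
  -- `J` lies below `p 0`, so the final spiral is paid for by the tour's first edge, from the root
  -- to `q 0`, which the joins do not use.
  have hJ0 : spiralRadius α J + pathLength l ≤ 2 * graphLength M := by
    have h2 : spiralRadius α J ≤ ‖q 0‖ := by
      rw [← (hp 0).1, norm_spiralPoint]
      exact spiralRadius_mono ht (hJ.1 ⟨0, ⟨le_rfl, Nat.zero_le _⟩, rfl⟩)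
    cases l with
    | nil => exact absurd hn hl0
    | cons x l =>
      have h3 : dist (⟨0, h0Q⟩ : withRoot P) x = ‖q 0‖ := by
        rw [Subtype.dist_eq, dist_zero_left]
        rfl
      rw [pathLength, h3] at hlen
      linarith
  have hJpos := spiralRadius_pos α J
  have hkF := mul_le_mul_of_nonneg_left hF (zero_le_one.trans hk1)
  -- As `k ≥ 1`, the term for the final spiral can carry the same factor as the joins, so it adds
  -- nothing to the constant.
  have hkK : 1 ≤ k * (3 / 2 * K) := one_le_mul_of_one_le_of_one_le hk1 (by linarith)
  have hR := le_mul_of_one_le_left hJpos.le hkK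
  have hfin := mul_le_mul_of_nonneg_left hJ0 (zero_le_one.trans hkK)
  rw [hkc, ← one_div_cos_mul_max h0 h1, ← hK,
    show 3 * (k : ℝ) * (1 / Real.cos α * K) * graphLength M =
      1 / Real.cos α * (k * (3 / 2 * K) * (2 * graphLength M)) by ring]
  refine mul_le_mul_of_nonneg_left ?_ (by positivity)
  linarith

theorem graphLength_nonneg {Q : Finset ℂ} (G : SimpleGraph Q) : 0 ≤ graphLength G := by
  unfold graphLength
  refine Finset.sum_nonneg fun e _ => ?_
  induction e with
  | _ x y => exact dist_nonneg (x := x) (y := y)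

/-- For `n ≥ 2` the binary logarithm is at least `1`, so rounding up at most doubles it. -/
theorem ceil_logb_two_le {n : ℕ} (hn : 2 ≤ n) :
    (⌈Real.logb 2 (n : ℝ)⌉ : ℝ) ≤ 2 / Real.log 2 * Real.log n := by
  have hlog : 0 < Real.log 2 := Real.log_pos one_lt_two
  have h1 : 1 ≤ Real.logb 2 (n : ℝ) := by
    rw [Real.le_logb_iff_rpow_le one_lt_two (by positivity), Real.rpow_one]
    exact_mod_cast hn
  have h2 := Int.ceil_lt_add_one (Real.logb 2 (n : ℝ))
  rw [show 2 / Real.log 2 * Real.log n = 2 * Real.logb 2 (n : ℝ) by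
    rw [Real.logb]; ring]
  linarith

theorem mainTheorem5 :
    -- the length of optimal spiral trees
    (∀ α : ℝ, 0 < α → α < Real.pi / 2 → ∀ P : Finset ℂ, 2 ≤ P.card →
      ∀ M : SimpleGraph (withRoot P), IsMinSpanningTree M →
        (∃ T : FluxTree α P, T.IsSpiralTree ∧
          T.length ≤ ENNReal.ofReal (3 * (⌈Real.logb 2 (P.card : ℝ)⌉ : ℝ) *
            max (1 / Real.cos α) (1 / Real.sin α) * graphLength M)) ∧
        (∀ T : FluxTree α P, T.IsOptimalSpiralTree →
          T.length ≤ ENNReal.ofReal (3 * (⌈Real.logb 2 (P.card : ℝ)⌉ : ℝ) *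
            max (1 / Real.cos α) (1 / Real.sin α) * graphLength M))) ∧
    -- the length of optimal flux trees
    (∃ C : ℝ, 0 < C ∧ ∀ α : ℝ, 0 < α → α < Real.pi / 2 → ∀ P : Finset ℂ, 2 ≤ P.card →
      ∀ M : SimpleGraph (withRoot P), IsMinSpanningTree M →
        (∃ T : FluxTree α P,
          T.length ≤ ENNReal.ofReal (C * (1 / Real.cos α + 1 / Real.sin α) *
            Real.log (P.card : ℝ) * graphLength M)) ∧
        (∀ T : FluxTree α P, T.IsOptimal →
          T.length ≤ ENNReal.ofReal (C * (1 / Real.cos α + 1 / Real.sin α) *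
            Real.log (P.card : ℝ) * graphLength M))) ∧
    -- the distance to the root in flux trees, in particular in optimal ones
    (∀ α : ℝ, 0 < α → α < Real.pi / 2 → ∀ (P : Finset ℂ) (T : FluxTree α P),
      ∀ v : T.Node, v ≠ T.root → ∀ t ∈ Set.Icc (0 : ℝ) 1,
        T.pointDist v t ≤ ENNReal.ofReal (1 / Real.cos α * ‖T.arc v t‖)) := by
  have hspiral : ∀ α : ℝ, 0 < α → α < Real.pi / 2 → ∀ P : Finset ℂ, 2 ≤ P.card →
      ∀ M : SimpleGraph (withRoot P), IsMinSpanningTree M →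
        ∃ T : FluxTree α P, T.IsSpiralTree ∧
          T.length ≤ ENNReal.ofReal (3 * (⌈Real.logb 2 (P.card : ℝ)⌉ : ℝ) *
            max (1 / Real.cos α) (1 / Real.sin α) * graphLength M) :=
    fun α h0 h1 P hP M hM => exists_spiralTree_length_le h0 h1 hP hM.1.connected
  have hlog : 0 < Real.log 2 := Real.log_pos one_lt_two
  -- The constant is `3` times the factor `2 / log 2` from `ceil_logb_two_le`.
  refine ⟨fun α h0 h1 P hP M hM => ?_, ⟨6 / Real.log 2, by positivity,
    fun α h0 h1 P hP M hM => ?_⟩, fun α h0 h1 P T v hv t ht => T.pointDist_le h0 h1 hv ht⟩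
  · obtain ⟨T, hT, hlen⟩ := hspiral α h0 h1 P hP M hM
    exact ⟨⟨T, hT, hlen⟩, fun T' hT' => (hT'.2 T hT).trans hlen⟩
  · obtain ⟨T, -, hlen⟩ := hspiral α h0 h1 P hP M hM
    have hcos : 0 < Real.cos α := Real.cos_pos_of_mem_Ioo ⟨by linarith, h1⟩
    have hsin : 0 < Real.sin α := Real.sin_pos_of_pos_of_lt_pi h0 (by linarith)
    have hbound : T.length ≤ ENNReal.ofReal (6 / Real.log 2 *
        (1 / Real.cos α + 1 / Real.sin α) * Real.log (P.card : ℝ) * graphLength M) := by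
      refine hlen.trans (ENNReal.ofReal_le_ofReal ?_)
      refine mul_le_mul_of_nonneg_right ?_ (graphLength_nonneg M)
      have hmax : max (1 / Real.cos α) (1 / Real.sin α) ≤ 1 / Real.cos α + 1 / Real.sin α :=
        max_le_add_of_nonneg (by positivity) (by positivity)
      have hceil := ceil_logb_two_le hP
      have hlogP : 0 ≤ Real.log (P.card : ℝ) := Real.log_natCast_nonneg _
      calc 3 * (⌈Real.logb 2 (P.card : ℝ)⌉ : ℝ) * max (1 / Real.cos α) (1 / Real.sin α)
          ≤ 3 * (2 / Real.log 2 * Real.log (P.card : ℝ)) *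
              (1 / Real.cos α + 1 / Real.sin α) := by
            gcongr
        _ = _ := by ring
    exact ⟨⟨T, hbound⟩, fun T' hT' => (hT' T).trans hbound⟩
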